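/- For $n\ge 5$ let $T_n^1$ and $T_n^2$ be the trees on the $n$ vertices $v_0,v_1,\ldots,v_{n-1}$ with edge sets $$E(T_n^1)=\{v_0v_1,\ldots,v_0v_{n-3},\,v_{n-4}v_{n-2},\,v_{n-3}v_{n-1}\},\qquad E(T_n^2)=\{v_0v_1,\ldots,v_0v_{n-3},\,v_{n-3}v_{n-2},\,v_{n-3}v_{n-1}\}.$$ Let $K_{1,m-1}$ be the star with $m-1$ edges (the complete bipartite graph with parts of sizes $1$ and $m-1$). For finite simple graphs $G_1,G_2$ let $r(G_1,G_2)$ be the smallest positive integer $N$ such that for every simple graph $G$ with $N$ vertices, $G$ contains a (not necessarily induced) copy of $G_1$ or the complement $\overline{G}$ contains a copy of $G_2$. Theorem 6.1. Let $m,n$ be positive integers with $m\ge 5$, $n\ge 8$ and $n>m$, and let $j\in\{1,2\}$. Then $r(K_{1,m-1},T_n^j)=m+n-4$ or $r(K_{1,m-1},T_n^j)=m+n-5$. Moreover, if $2\mid mn$, then $r(K_{1,m-1},T_n^j)=m+n-4$. -/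

import Mathlib

/-- The tree `T_n^1` on the vertices `v_0, …, v_{n-1}`, with edges `v_0 v_i` for `1 ≤ i ≤ n - 3`,
together with `v_{n-4} v_{n-2}` and `v_{n-3} v_{n-1}`. It is meant for `n ≥ 5`. -/
def treeOne (n : ℕ) : SimpleGraph (Fin n) :=
  SimpleGraph.fromRel fun u v =>
    (u.val = 0 ∧ 1 ≤ v.val ∧ v.val + 3 ≤ n) ∨
    (u.val + 4 = n ∧ v.val + 2 = n) ∨
    (u.val + 3 = n ∧ v.val + 1 = n)

/-- The tree `T_n^2` on the vertices `v_0, …, v_{n-1}`, with edges `v_0 v_i` for `1 ≤ i ≤ n - 3`,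
together with `v_{n-3} v_{n-2}` and `v_{n-3} v_{n-1}`. It is meant for `n ≥ 5`. -/
def treeTwo (n : ℕ) : SimpleGraph (Fin n) :=
  SimpleGraph.fromRel fun u v =>
    (u.val = 0 ∧ 1 ≤ v.val ∧ v.val + 3 ≤ n) ∨
    (u.val + 3 = n ∧ v.val + 2 = n) ∨
    (u.val + 3 = n ∧ v.val + 1 = n)

/-- The Ramsey number `r(G₁, G₂)`: the smallest positive integer `N` such that, for every graph `G`
with `N` vertices, `G` contains a copy of `G₁` or the complement of `G` contains a copy of `G₂`
(a copy is a not necessarily induced subgraph). It would be `0` only if no such `N` existed. -/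
noncomputable def ramseyNumber {V W : Type*} (G₁ : SimpleGraph V) (G₂ : SimpleGraph W) : ℕ :=
  sInf {N : ℕ | 0 < N ∧ ∀ G : SimpleGraph (Fin N), G₁.IsContained G ∨ G₂.IsContained Gᶜ}

/-! Upper bound: if `G` on `m + n - 4` vertices has no `K_{1,m-1}`, its degrees are at most `m - 2`,
so its complement has minimum degree at least `n - 3`. This forces both trees
(`treeOne_isContained_of_le_degree`, `treeTwo_isContained_of_le_degree`): take a star with centre
`v` and a set `S` of `n - 3` leaves, and let `R` be the remaining vertices. Either edges between `S`
and `R` complete the tree, or they are so sparse that `|R| = n - 3` and a star with another centre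
works. Lower bound: a `k`-regular graph with `k ≤ m - 2` on at most `k + n - 3` vertices avoids the
star, and its complement has degrees below `n - 3`, the degree of `v_0`. Parity decides which
regular graphs exist (`exists_regular`). -/

/-- The vertices `v`, `S`, `x`, `y` can be enumerated by `Fin n`, starting with `v` and ending with
`a`, `b`, `x`, `y`, where `a` and `b` belong to `S`. -/
theorem exists_embedding_of_star {V : Type*} [DecidableEq V] {n : ℕ} (hn : 5 ≤ n) {v a b x y : V}
    {S : Finset V} (hS : S.card = n - 3) (hvS : v ∉ S) (ha : a ∈ S) (hb : b ∈ S) (hab : a ≠ b)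
    (hx : x ∉ S) (hy : y ∉ S) (hxv : x ≠ v) (hyv : y ≠ v) (hxy : x ≠ y) :
    ∃ f : Fin n ↪ V, ∀ i : Fin n, (i.val = 0 → f i = v) ∧ (1 ≤ i.val → i.val + 3 ≤ n → f i ∈ S) ∧
      (i.val + 4 = n → f i = a) ∧ (i.val + 3 = n → f i = b) ∧
      (i.val + 2 = n → f i = x) ∧ (i.val + 1 = n → f i = y) := by
  set L := ((S.erase a).erase b).toList with hL
  have hlen : L.length = n - 5 := by
    rw [hL, Finset.length_toList, Finset.card_erase_of_mem (by simp [hb, hab.symm]),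
      Finset.card_erase_of_mem ha]
    omega
  have hmem : ∀ z, z ∈ L ↔ z ≠ b ∧ z ≠ a ∧ z ∈ S := by simp [hL]
  have hnd : (v :: (L ++ [a, b, x, y])).Nodup := by
    have : L.Nodup := Finset.nodup_toList _
    simp only [List.nodup_cons, List.nodup_append, List.mem_append, hmem, List.mem_cons,
      List.not_mem_nil]
    grind
  have hlen' : (v :: (L ++ [a, b, x, y])).length = n := by simp [hlen]; omega
  obtain ⟨f, hf0, hf⟩ : ∃ f : Fin n ↪ V, (∀ h, f ⟨0, h⟩ = v) ∧ ∀ i (hi : i + 1 < n),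
      f ⟨i + 1, hi⟩ = (L ++ [a, b, x, y])[i]'(by simp at hlen' ⊢; omega) :=
    ⟨⟨fun i => (v :: (L ++ [a, b, x, y]))[i.val]'(by rw [hlen']; exact i.isLt),
      fun i j hij => Fin.ext ((hnd.getElem_inj_iff).1 hij)⟩, fun _ => rfl, fun _ _ => rfl⟩
  refine ⟨f, fun i => ?_⟩
  obtain ⟨i, hi⟩ := i
  rcases i with _ | i
  · simp only [hf0]
    refine ⟨by simp, ?_, ?_, ?_, ?_, ?_⟩ <;> intros <;> omega
  · simp only [hf]
    refine ⟨by simp, fun _ h => ?_, fun h => ?_, fun h => ?_, fun h => ?_, fun h => ?_⟩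
    · by_cases h1 : i < L.length
      · rw [List.getElem_append_left h1]
        exact ((hmem _).1 (List.getElem_mem h1)).2.2
      · rw [List.getElem_append_right (by omega)]
        obtain h2 | h2 : i - L.length = 0 ∨ i - L.length = 1 := by omega
        · simp [h2, ha]
        · simp [h2, hb]
    all_goals rw [List.getElem_append_right (by omega)]
    · simp [show i - L.length = 0 by omega]
    · simp [show i - L.length = 1 by omega]
    · simp [show i - L.length = 2 by omega]
    · simp [show i - L.length = 3 by omega]

/-! ### Copies of trees and stars; regular graphs -/

namespace SimpleGraph

variable {V : Type*} {H : SimpleGraph V} {n : ℕ}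

theorem treeOne_isContained [DecidableEq V] (hn : 5 ≤ n) {v a b x y : V}
    {S : Finset V} (hS : S.card = n - 3) (hvS : ∀ z ∈ S, H.Adj v z) (ha : a ∈ S) (hb : b ∈ S)
    (hab : a ≠ b) (hx : x ∉ S) (hy : y ∉ S) (hxv : x ≠ v) (hyv : y ≠ v) (hxy : x ≠ y)
    (hax : H.Adj a x) (hby : H.Adj b y) : (treeOne n).IsContained H := by
  obtain ⟨f, hf⟩ := exists_embedding_of_star hn hS (fun h => H.irrefl (hvS v h)) ha hb hab hx hy
    hxv hyv hxy
  have key : ∀ i j : Fin n, ((i.val = 0 ∧ 1 ≤ j.val ∧ j.val + 3 ≤ n) ∨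
      (i.val + 4 = n ∧ j.val + 2 = n) ∨ (i.val + 3 = n ∧ j.val + 1 = n)) → H.Adj (f i) (f j) := by
    rintro i j (⟨h1, h2, h3⟩ | ⟨h1, h2⟩ | ⟨h1, h2⟩)
    · rw [(hf i).1 h1]
      exact hvS _ ((hf j).2.1 h2 h3)
    · rwa [(hf i).2.2.1 h1, (hf j).2.2.2.2.1 h2]
    · rwa [(hf i).2.2.2.1 h1, (hf j).2.2.2.2.2 h2]
  refine isContained_iff_exists_le_comap.2 ⟨f, fun i j hij => ?_⟩
  rcases ((fromRel_adj _ _ _).1 hij).2 with h | h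
  · exact key i j h
  · exact (key j i h).symm

theorem treeTwo_isContained [DecidableEq V] (hn : 5 ≤ n) {v b x y : V}
    {S : Finset V} (hS : S.card = n - 3) (hvS : ∀ z ∈ S, H.Adj v z) (hb : b ∈ S)
    (hx : x ∉ S) (hy : y ∉ S) (hxv : x ≠ v) (hyv : y ≠ v) (hxy : x ≠ y)
    (hbx : H.Adj b x) (hby : H.Adj b y) : (treeTwo n).IsContained H := by
  obtain ⟨a, ha, hab⟩ := S.exists_mem_ne (by omega) b
  obtain ⟨f, hf⟩ := exists_embedding_of_star hn hS (fun h => H.irrefl (hvS v h)) ha hb hab hx hy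
    hxv hyv hxy
  have key : ∀ i j : Fin n, ((i.val = 0 ∧ 1 ≤ j.val ∧ j.val + 3 ≤ n) ∨
      (i.val + 3 = n ∧ j.val + 2 = n) ∨ (i.val + 3 = n ∧ j.val + 1 = n)) → H.Adj (f i) (f j) := by
    rintro i j (⟨h1, h2, h3⟩ | ⟨h1, h2⟩ | ⟨h1, h2⟩)
    · rw [(hf i).1 h1]
      exact hvS _ ((hf j).2.1 h2 h3)
    · rwa [(hf i).2.2.2.1 h1, (hf j).2.2.2.2.1 h2]
    · rwa [(hf i).2.2.2.1 h1, (hf j).2.2.2.2.2 h2]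
  refine isContained_iff_exists_le_comap.2 ⟨f, fun i j hij => ?_⟩
  rcases ((fromRel_adj _ _ _).1 hij).2 with h | h
  · exact key i j h
  · exact (key j i h).symm

theorem star_isContained {k : ℕ} (v : V) [Fintype (H.neighborSet v)] (h : k ≤ H.degree v) :
    (completeBipartiteGraph (Fin 1) (Fin k)).IsContained H := by
  rw [completeBipartiteGraph_isContained_iff]
  obtain ⟨t, ht, hc⟩ := Finset.exists_subset_card_eq h
  refine ⟨{v}, t, by simp, by simp [hc], ?_⟩
  intro x hx y hy
  have := ht hy
  simp_all

theorem le_degree_of_isContained {W : Type*} {A : SimpleGraph W} [Fintype V] [DecidableRel H.Adj]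
    (h : A.IsContained H) (w : W) (s : Finset W) (hs : ∀ z ∈ s, A.Adj w z) :
    ∃ v, s.card ≤ H.degree v := by
  obtain ⟨f⟩ := h
  refine ⟨f w, ?_⟩
  rw [← Finset.card_map ⟨f, f.injective⟩]
  refine Finset.card_le_card fun y hy => ?_
  obtain ⟨z, hz, rfl⟩ := Finset.mem_map.1 hy
  simpa using f.toHom.map_adj (hs z hz)

/-- A circulant graph on `Fin N`, whose connection set `A` is symmetric under `x ↦ N - x` and has
`k` elements. -/
theorem exists_regular (N k : ℕ) (hk : k < N) (hp : 2 ∣ k * N) :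
    ∃ G : SimpleGraph (Fin N), ∃ _ : DecidableRel G.Adj, ∀ v, G.degree v = k := by
  obtain ⟨A, hA, hcard, h0, hsymm⟩ : ∃ A : Finset ℕ, A ⊆ Finset.range N ∧ A.card = k ∧ 0 ∉ A ∧
      ∀ x, 0 < x → x < N → (N - x ∈ A ↔ x ∈ A) := by
    by_cases hpar : 2 ∣ N + 1 - k
    -- The interval of `k` elements centred at `N / 2`.
    · refine ⟨Finset.Icc ((N + 1 - k) / 2) (N - (N + 1 - k) / 2), ?_, ?_, ?_, ?_⟩
      · intro x; simp; omega
      · simp; omega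
      · simp; omega
      · intro x; simp; omega
    · have : 2 ∣ k ∧ 2 ∣ N := by
        rcases (Nat.prime_two.dvd_mul).1 hp with h | h <;> omega
      -- `k / 2` elements at each end of `1, …, N - 1`.
      refine ⟨Finset.Icc 1 (N - 1) \ Finset.Icc (k / 2 + 1) (N - (k / 2 + 1)), ?_, ?_, ?_, ?_⟩
      · intro x; simp; omega
      · rw [Finset.card_sdiff_of_subset (by intro x; simp; omega)]
        simp; omega
      · simp
      · intro x; simp; omega
  have : NeZero N := ⟨by omega⟩
  let G : SimpleGraph (Fin N) :=
    { Adj := fun u v => (v - u).val ∈ A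
      symm := ⟨fun u v h => by
        have h1 : 0 < (v - u).val := Nat.pos_of_ne_zero fun h' => h0 (h' ▸ h)
        have h2 : (u - v).val = N - (v - u).val := by
          rw [← neg_sub v u, Fin.val_neg, if_neg]
          exact fun h' => by simp [h'] at h1
        rw [h2]
        exact (hsymm _ h1 (v - u).isLt).2 h⟩
      loopless := ⟨fun u h => by simp [h0] at h⟩ }
  refine ⟨G, fun u v => inferInstanceAs (Decidable ((v - u).val ∈ A)), fun v => ?_⟩
  rw [← hcard, ← card_neighborFinset_eq_degree]
  refine Finset.card_bij (fun w _ => (w - v).val) ?_ ?_ ?_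
  · intro w hw
    exact (mem_neighborFinset _ _ _).1 hw
  · intro w _ w' _ h
    exact sub_left_injective (Fin.ext h)
  · intro a ha
    have hlt := Finset.mem_range.1 (hA ha)
    refine ⟨⟨a, hlt⟩ + v, (mem_neighborFinset _ _ _).2 ?_, by simp⟩
    change ((⟨a, hlt⟩ : Fin N) + v - v).val ∈ A
    simpa using ha

end SimpleGraph

/-! ### Minimum degree `n - 3` forces the trees -/

namespace SimpleGraph

variable {V : Type*} [Fintype V] [DecidableEq V] {H : SimpleGraph V} [DecidableRel H.Adj] {d : ℕ}

/-- If some degree equals `d`, let `S` be that whole neighbourhood, so that `r` is not adjacent to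
`v`. Otherwise all degrees exceed `d`, and removing `v` costs at most one. -/
theorem exists_star_with_rich_complement [Nonempty V] (hd : ∀ v, d ≤ H.degree v) :
    ∃ v, ∃ S : Finset V, S.card = d ∧ (∀ z ∈ S, H.Adj v z) ∧
      ∀ r, r ≠ v → r ∉ S → d ≤ ((H.neighborFinset r).erase v).card := by
  by_cases h : ∃ v, H.degree v = d
  · obtain ⟨v, hv⟩ := h
    refine ⟨v, H.neighborFinset v, hv, by simp, fun r _ hr => ?_⟩
    rw [Finset.erase_eq_of_notMem]
    · exact hd r
    · simpa [adj_comm] using hr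
  · have v := Classical.arbitrary V
    obtain ⟨S, hS, hc⟩ := Finset.exists_subset_card_eq (s := H.neighborFinset v) (hd v)
    refine ⟨v, S, hc, fun z hz => by simpa using hS hz, fun r _ _ => ?_⟩
    have h1 : d < H.degree r := lt_of_le_of_ne (hd r) fun h' => h ⟨r, h'.symm⟩
    have h2 := Finset.pred_card_le_card_erase (s := H.neighborFinset r) (a := v)
    rw [card_neighborFinset_eq_degree] at h2
    omega

theorem le_card_neighborFinset_inter_add {v r : V} {S R : Finset V}
    (hR : ∀ z, z ∈ R ↔ z ≠ v ∧ z ∉ S) (hr : r ∈ R)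
    (hd : d ≤ ((H.neighborFinset r).erase v).card) :
    d + 1 ≤ (H.neighborFinset r ∩ S).card + R.card := by
  have h1 : (H.neighborFinset r).erase v ⊆ (H.neighborFinset r ∩ S) ∪ R.erase r := by
    intro z hz
    have : z ≠ r := by rintro rfl; simp at hz
    simp_all; tauto
  have h2 := (Finset.card_le_card h1).trans (Finset.card_union_le _ _)
  rw [Finset.card_erase_of_mem hr] at h2
  have := Finset.card_pos.2 ⟨r, hr⟩
  omega

theorem treeOne_isContained_of_le_degree {n : ℕ} (hn : 8 ≤ n) (hV : n + 1 ≤ Fintype.card V)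
    (hV' : Fintype.card V + 5 ≤ 2 * n) (hd : ∀ v, n - 3 ≤ H.degree v) :
    (treeOne n).IsContained H := by
  have : Nonempty V := Fintype.card_pos_iff.1 (by omega)
  obtain ⟨v, S, hS, hvS, hr⟩ := exists_star_with_rich_complement hd
  have hv : v ∉ S := fun h => H.irrefl (hvS v h)
  obtain ⟨R, hR⟩ : ∃ R : Finset V, R = (insert v S)ᶜ := ⟨_, rfl⟩
  have hRc : R.card = Fintype.card V - (n - 2) := by
    rw [hR, Finset.card_compl, Finset.card_insert_of_notMem hv]; omega
  replace hR : ∀ z, z ∈ R ↔ z ≠ v ∧ z ∉ S := by simp [hR]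
  by_contra hcon
  have hmat : ∀ a ∈ S, ∀ b ∈ S, ∀ x ∈ R, ∀ y ∈ R, x ≠ y → H.Adj a x → H.Adj b y → a = b := by
    intro a ha b hb x hx y hy hxy hax hby
    by_contra hab
    rw [hR] at hx hy
    exact hcon (treeOne_isContained (by omega) hS hvS ha hb hab hx.2 hy.2 hx.1 hy.1 hxy hax hby)
  have hcard : ∀ r ∈ R, n - 2 ≤ (H.neighborFinset r ∩ S).card + R.card := fun r hrR => by
    have := le_card_neighborFinset_inter_add hR hrR (hr r ((hR r).1 hrR).1 ((hR r).1 hrR).2)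
    omega
  have hex : ∀ r ∈ R, ∃ a ∈ S, H.Adj a r := fun r hrR => by
    have := hcard r hrR
    obtain ⟨a, ha⟩ := Finset.card_pos.1 (show 0 < (H.neighborFinset r ∩ S).card by omega)
    simp only [Finset.mem_inter, mem_neighborFinset] at ha
    exact ⟨a, ha.2, ha.1.symm⟩
  obtain ⟨r, hrR⟩ := Finset.card_pos.1 (show 0 < R.card by omega)
  obtain ⟨u, huS, hur⟩ := hex r hrR
  -- The edges between `S` and `R` contain no two disjoint ones, yet cover `R`, which has at least
  -- three vertices; they form a star centred at `u`.
  have huR : ∀ x ∈ R, H.Adj u x := by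
    intro x hx
    by_cases hxr : x = r
    · rwa [hxr]
    · obtain ⟨a, ha, hax⟩ := hex x hx
      rwa [hmat u huS a ha r hrR x hx (Ne.symm hxr) hur hax]
  have hru : ∀ a ∈ S, H.Adj a r → a = u := by
    intro a ha har
    obtain ⟨x, hx, hxr⟩ := R.exists_mem_ne (by omega) r
    exact hmat a ha u huS r hrR x hx hxr.symm har (huR x hx)
  have hsub : H.neighborFinset r ∩ S ⊆ {u} := fun a ha => by
    simp only [Finset.mem_inter, mem_neighborFinset] at ha
    exact Finset.mem_singleton.2 (hru a ha.2 ha.1.symm)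
  have h1 := Finset.card_le_card hsub
  have h2 := hcard r hrR
  rw [Finset.card_singleton] at h1
  obtain ⟨r', hr', hr'u⟩ := Finset.exists_mem_ne
    (by have := hr r ((hR r).1 hrR).1 ((hR r).1 hrR).2; omega) u
    (s := (H.neighborFinset r).erase v)
  simp only [Finset.mem_erase, mem_neighborFinset] at hr'
  have hr'S : r' ∉ S := fun h => hr'u (hru r' h hr'.2.symm)
  have hr'R : r' ∈ R := (hR _).2 ⟨hr'.1, hr'S⟩
  obtain ⟨g, hg, hgu⟩ := S.exists_mem_ne (by omega) u
  have hvR : v ∉ R := by simp [hR]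
  -- By `h1` and `h2`, `|R| = n - 3`. Recentre at `u`, with `v` replacing `r` among the leaves; `g`
  -- hangs from `v` and `r` from `r'`.
  refine hcon (treeOne_isContained (v := u) (a := v) (b := r') (x := g) (y := r)
    (S := insert v (R.erase r)) (by omega) ?_ ?_ ?_ ?_ ?_ ?_ ?_ hgu ?_ ?_ (hvS g hg) hr'.2.symm)
  · rw [Finset.card_insert_of_notMem (by simp [hvR]), Finset.card_erase_of_mem hrR]
    omega
  · intro z hz
    rcases Finset.mem_insert.1 hz with rfl | hz
    · exact (hvS u huS).symm
    · exact huR z (Finset.mem_of_mem_erase hz)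
  · simp
  · simp [hr'R, hr'.2.ne']
  · exact hr'.1.symm
  · have : g ∉ R := by simp [hR, hg]
    simp [this, (hvS g hg).ne']
  · simp [((hR r).1 hrR).1]
  · exact hur.ne'
  · rintro rfl
    exact ((hR g).1 hrR).2 hg

theorem treeTwo_isContained_of_le_degree {n : ℕ} (hn : 8 ≤ n) (hV : n + 1 ≤ Fintype.card V)
    (hV' : Fintype.card V + 5 ≤ 2 * n) (hd : ∀ v, n - 3 ≤ H.degree v) :
    (treeTwo n).IsContained H := by
  have : Nonempty V := Fintype.card_pos_iff.1 (by omega)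
  obtain ⟨v, S, hS, hvS, hr⟩ := exists_star_with_rich_complement hd
  have hv : v ∉ S := fun h => H.irrefl (hvS v h)
  obtain ⟨R, hR⟩ : ∃ R : Finset V, R = (insert v S)ᶜ := ⟨_, rfl⟩
  have hRc : R.card = Fintype.card V - (n - 2) := by
    rw [hR, Finset.card_compl, Finset.card_insert_of_notMem hv]; omega
  replace hR : ∀ z, z ∈ R ↔ z ≠ v ∧ z ∉ S := by simp [hR]
  by_contra hcon
  have hone : ∀ b ∈ S, ∀ x ∈ R, ∀ y ∈ R, H.Adj b x → H.Adj b y → x = y := by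
    intro b hb x hx y hy hbx hby
    by_contra hxy
    rw [hR] at hx hy
    exact hcon (treeTwo_isContained (by omega) hS hvS hb hx.2 hy.2 hx.1 hy.1 hxy hbx hby)
  have hcard : ∀ r ∈ R, n - 2 ≤ (H.neighborFinset r ∩ S).card + R.card := fun r hrR => by
    have := le_card_neighborFinset_inter_add hR hrR (hr r ((hR r).1 hrR).1 ((hR r).1 hrR).2)
    omega
  -- Double counting: each vertex of `S` has at most one neighbour in `R`.
  have hcount : ∀ c, (∀ r ∈ R, c ≤ (H.neighborFinset r ∩ S).card) → R.card * c ≤ n - 3 := by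
    intro c hc
    have := Finset.card_mul_le_card_mul (s := R) (t := S) (m := c) (n := 1) H.Adj ?_ ?_
    · omega
    · intro r hrR
      refine (hc r hrR).trans (Finset.card_le_card fun z hz => ?_)
      simp only [Finset.mem_inter, mem_neighborFinset] at hz
      simp [Finset.mem_bipartiteAbove, hz.1, hz.2]
    · intro b hb
      refine Finset.card_le_one.2 fun x hx y hy => ?_
      rw [Finset.mem_bipartiteBelow] at hx hy
      exact hone b hb x hx.1 y hy.1 hx.2.symm hy.2.symm
  have hRn : R.card = n - 3 := by
    by_contra hne
    -- `|R| (n - 2 - |R|) ≤ n - 3` fails for `3 ≤ |R| ≤ n - 4`, by concavity.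
    have h1 := hcount (n - 2 - R.card) fun r hrR => by have := hcard r hrR; omega
    obtain ⟨p, hp⟩ : ∃ p, n - 2 - R.card = p + 2 := ⟨n - 4 - R.card, by omega⟩
    obtain ⟨q, hq⟩ : ∃ q, R.card = q + 3 := ⟨R.card - 3, by omega⟩
    rw [hp, hq] at h1
    have : p + 2 + (q + 3) = n - 2 := by omega
    have : (q + 3) * (p + 2) ≤ p + q + 4 := by omega
    nlinarith
  obtain ⟨r, hrR, hr1⟩ : ∃ r ∈ R, (H.neighborFinset r ∩ S).card ≤ 1 := by
    by_contra! h
    have := hcount 2 h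
    omega
  have hrv := (hR r).1 hrR
  have h0 := hcard r hrR
  obtain ⟨g, hg⟩ := Finset.card_eq_one.1 (show (H.neighborFinset r ∩ S).card = 1 by omega)
  have hg' : g ∈ H.neighborFinset r ∩ S := by simp [hg]
  simp only [Finset.mem_inter, mem_neighborFinset] at hg'
  have hgR : g ∉ R := by simp [hR, hg'.2]
  have hsub : (H.neighborFinset r).erase v ⊆ insert g (R.erase r) := by
    intro z hz
    simp only [Finset.mem_erase, mem_neighborFinset] at hz
    by_cases hzS : z ∈ S
    · have : z ∈ H.neighborFinset r ∩ S := by simp [hz.2, hzS]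
      rw [hg, Finset.mem_singleton] at this
      simp [this]
    · simp [hR, hz.1, hzS, hz.2.ne']
  have hc : (insert g (R.erase r)).card = n - 3 := by
    rw [Finset.card_insert_of_notMem (by simp [hgR]), Finset.card_erase_of_mem hrR]
    omega
  -- So `r` is adjacent to `g` and to all of `R` except itself, and becomes the new centre.
  have heq := Finset.eq_of_subset_of_card_le hsub (by rw [hc]; exact hr r hrv.1 hrv.2)
  obtain ⟨g', hg1, hg2⟩ : ∃ g' ∈ H.neighborFinset g, g' ∉ ({v, r} : Finset V) := by
    refine Finset.exists_mem_notMem_of_card_lt_card (lt_of_le_of_lt Finset.card_le_two ?_)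
    have := hd g
    rw [card_neighborFinset_eq_degree]
    omega
  simp only [Finset.mem_insert, Finset.mem_singleton, not_or, mem_neighborFinset] at hg1 hg2
  have hg'R : g' ∉ R := fun h => hg2.2 (hone g hg'.2 g' h r hrR hg1 hg'.1.symm)
  refine hcon (treeTwo_isContained (v := r) (b := g) (x := v) (y := g')
    (S := insert g (R.erase r)) (by omega) hc ?_ (by simp) ?_ ?_ hrv.1.symm hg2.2
    (Ne.symm hg2.1) (hvS g hg'.2).symm hg1)
  · intro z hz
    rw [← heq] at hz
    simpa using Finset.mem_of_mem_erase hz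
  · simp [hR, (hvS g hg'.2).ne]
  · simp [hg1.ne', hg'R]

end SimpleGraph

/-! ### Bounds on the Ramsey number -/

open SimpleGraph

/-- Restrict `G` to its first `M` vertices. By this monotonicity, one bad graph on `M` vertices
excludes every value up to `M`. -/
theorem forall_isContained_or_of_le {V W : Type*} {A : SimpleGraph V} {B : SimpleGraph W}
    {M N : ℕ} (hMN : M ≤ N) (h : ∀ G : SimpleGraph (Fin M), A.IsContained G ∨ B.IsContained Gᶜ)
    (G : SimpleGraph (Fin N)) : A.IsContained G ∨ B.IsContained Gᶜ := by
  have hi := Fin.castLE_injective hMN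
  refine (h (G.comap (Fin.castLE hMN))).imp (fun h => h.trans ?_) (fun h => h.trans ?_)
  · exact isContained_iff_exists_le_comap.2 ⟨⟨_, hi⟩, le_rfl⟩
  · refine isContained_iff_exists_le_comap.2 ⟨⟨_, hi⟩, fun u v huv => ?_⟩
    rw [compl_adj] at huv
    exact (compl_adj _ _ _).2 ⟨fun h => huv.1 (hi h), huv.2⟩

theorem ramseyNumber_le {V W : Type*} {A : SimpleGraph V} {B : SimpleGraph W} {N : ℕ}
    (hN : 0 < N) (h : ∀ G : SimpleGraph (Fin N), A.IsContained G ∨ B.IsContained Gᶜ) :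
    ramseyNumber A B ≤ N :=
  Nat.sInf_le ⟨hN, h⟩

theorem lt_ramseyNumber {V W : Type*} {A : SimpleGraph V} {B : SimpleGraph W} {M N : ℕ}
    (hN : 0 < N) (h : ∀ G : SimpleGraph (Fin N), A.IsContained G ∨ B.IsContained Gᶜ)
    (G : SimpleGraph (Fin M)) (hA : ¬ A.IsContained G) (hB : ¬ B.IsContained Gᶜ) :
    M < ramseyNumber A B := by
  by_contra! hle
  have hmem : ramseyNumber A B ∈ {N : ℕ | 0 < N ∧
    ∀ G : SimpleGraph (Fin N), A.IsContained G ∨ B.IsContained Gᶜ} := Nat.sInf_mem ⟨N, hN, h⟩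
  exact (forall_isContained_or_of_le hle hmem.2 G).elim hA hB

theorem star_or_tree_isContained {m n : ℕ} (hm : 5 ≤ m) (hn : 8 ≤ n) (hmn : m < n)
    {T : SimpleGraph (Fin n)} (hT : T = treeOne n ∨ T = treeTwo n)
    (G : SimpleGraph (Fin (m + n - 4))) :
    (completeBipartiteGraph (Fin 1) (Fin (m - 1))).IsContained G ∨ T.IsContained Gᶜ := by
  classical
  by_cases h : ∃ v, m - 1 ≤ G.degree v
  · obtain ⟨v, hv⟩ := h
    exact Or.inl (star_isContained v hv)
  · right
    push Not at h
    have hd : ∀ v, n - 3 ≤ Gᶜ.degree v := fun v => by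
      have := h v
      rw [degree_compl, Fintype.card_fin]
      omega
    rcases hT with rfl | rfl
    · exact treeOne_isContained_of_le_degree hn (by simp; omega) (by simp; omega) hd
    · exact treeTwo_isContained_of_le_degree hn (by simp; omega) (by simp; omega) hd

theorem exists_avoiding_star_and_tree {m n k N : ℕ} (hn : 5 ≤ n)
    {T : SimpleGraph (Fin n)} (hT : T = treeOne n ∨ T = treeTwo n) (hk : k < N)
    (hp : 2 ∣ k * N) (hkm : k + 1 < m) (hkn : N ≤ k + n - 3) :
    ∃ G : SimpleGraph (Fin N), ¬ (completeBipartiteGraph (Fin 1) (Fin (m - 1))).IsContained G ∧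
      ¬ T.IsContained Gᶜ := by
  obtain ⟨G, _, hG⟩ := exists_regular N k hk hp
  refine ⟨G, fun h => ?_, fun h => ?_⟩
  · obtain ⟨v, hv⟩ := le_degree_of_isContained h (Sum.inl 0)
      (Finset.univ.map Function.Embedding.inr) (by simp)
    rw [hG, Finset.card_map, Finset.card_univ, Fintype.card_fin] at hv
    omega
  · let z : Fin n := ⟨0, by omega⟩
    have hadj : ∀ w ∈ Finset.Icc (⟨1, by omega⟩ : Fin n) ⟨n - 3, by omega⟩, T.Adj z w := by
      intro w hw
      simp only [Finset.mem_Icc, Fin.le_def] at hw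
      rcases hT with rfl | rfl <;> refine (fromRel_adj _ _ _).2 ⟨?_, Or.inl (Or.inl ?_)⟩ <;>
        simp [z, Fin.ext_iff] <;> omega
    obtain ⟨v, hv⟩ := le_degree_of_isContained h z _ hadj
    rw [degree_compl, hG, Fin.card_Icc, Fintype.card_fin] at hv
    simp at hv
    omega

theorem theorem6p1 (m n : ℕ) (hm : 5 ≤ m) (hn : 8 ≤ n) (hmn : m < n)
    (T : SimpleGraph (Fin n)) (hT : T = treeOne n ∨ T = treeTwo n) :
    (ramseyNumber (completeBipartiteGraph (Fin 1) (Fin (m - 1))) T = m + n - 4 ∨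
      ramseyNumber (completeBipartiteGraph (Fin 1) (Fin (m - 1))) T = m + n - 5) ∧
    (2 ∣ m * n →
      ramseyNumber (completeBipartiteGraph (Fin 1) (Fin (m - 1))) T = m + n - 4) := by
  have hpos : 0 < m + n - 4 := by omega
  have hall := star_or_tree_isContained hm hn hmn hT
  have hle := ramseyNumber_le hpos hall
  have hlow : m + n - 6 < ramseyNumber (completeBipartiteGraph (Fin 1) (Fin (m - 1))) T := by
    -- An even `k` needs no parity condition on the number of vertices.
    obtain ⟨k, hk, hp⟩ : ∃ k, (k + 2 = m ∨ k + 3 = m) ∧ 2 ∣ k := by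
      by_cases h : 2 ∣ m
      · exact ⟨m - 2, by omega, by omega⟩
      · exact ⟨m - 3, by omega, by omega⟩
    obtain ⟨G, h1, h2⟩ := exists_avoiding_star_and_tree (m := m) (k := k) (N := m + n - 6)
      (by omega) hT (by omega) (hp.mul_right _) (by omega) (by omega)
    exact lt_ramseyNumber hpos hall G h1 h2
  refine ⟨by omega, fun hdvd => ?_⟩
  have hp : 2 ∣ (m - 2) * (m + n - 5) := by
    by_cases h : 2 ∣ m
    · exact Dvd.dvd.mul_right (by omega) _
    · have := (Nat.prime_two.dvd_mul.1 hdvd).resolve_left h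
      exact Dvd.dvd.mul_left (by omega) _
  obtain ⟨G, h1, h2⟩ := exists_avoiding_star_and_tree (m := m) (k := m - 2) (N := m + n - 5)
    (by omega) hT (by omega) hp (by omega) (by omega)
  have := lt_ramseyNumber hpos hall G h1 h2
  omega
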